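/- Graphs are finite, simple and undirected, $G=(V,E)$, and $\bot\notin V$ is an extra element. A \emph{transformation} on $G$ is a map $\phi:V\cup\{\bot\}\to V\cup\{\bot\}$ with $\phi(\bot)=\bot$ that is injective on $\{v\in V:\phi(v)\neq\bot\}$; its \emph{loss} is $\mathrm{loss}(\phi)=|\{v\in V:\phi(v)=\bot\}|$. A \emph{translation} on $G$ is a transformation $\psi$ such that $\{v,\psi(v)\}\in E$ for every $v\in V$ with $\psi(v)\ne\bot$, and such that, for all $v_1,v_2\in V$ with $\psi(v_1),\psi(v_2)\neq\bot$, one has $\{v_1,v_2\}\in E$ if and only if $\{\psi(v_1),\psi(v_2)\}\in E$. For translations $\psi_1,\psi_2$ on $G$ write $\psi_1\prec\psi_2$ if $\mathrm{loss}(\psi_1)>\mathrm{loss}(\psi_2)$ and $\psi_1(v)=\psi_2(v)$ for some $v\in V$. A translation $\psi_1$ is \emph{minimal} if there is no translation $\psi_2$ on $G$ with $\psi_1\prec\psi_2$. Let $D\ge 1$ and let $d=(d[1],\dots,d[D])$ be a vector of positive integers. The \emph{grid graph} of dimensions $d$ has vertex set $V_g=\{1,\dots,d[1]\}\times\dots\times\{1,\dots,d[D]\}$,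 two vertices being adjacent if and only if they differ by exactly $1$ in one coordinate and agree in all the others. \textbf{Proposition.} Assume that $d[D]\ge 3$ and that $d[i]\ge 2+2\prod_{j=i+1}^{D}d[j]$ for all $i\in\{1,\dots,D-1\}$. Let $e_1=(1,0,\dots,0)$, and let $\psi_1$ be given by $\psi_1(\bot)=\bot$ and, for $v\in V_g$, $\psi_1(v)=v+e_1$ if $v+e_1\in V_g$ and $\psi_1(v)=\bot$ otherwise. Then $\psi_1$ is a minimal translation on the grid graph of dimensions $d$. -/

import Mathlib

namespace GraphTranslation

section General

variable {V : Type*}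

/-- A transformation on a graph with vertex set `V`: a self-map of `V ∪ {⊥}` that sends `⊥` to `⊥`
and is injective on the vertices whose image is not `⊥`. -/
@[ext]
structure Transformation (V : Type*) where
  toFun : WithBot V → WithBot V
  injective' : ∀ v₁ v₂ : V, toFun v₁ ≠ ⊥ → toFun v₂ ≠ ⊥ → toFun v₁ = toFun v₂ → v₁ = v₂
  map_bot' : toFun ⊥ = ⊥

instance : CoeFun (Transformation V) (fun _ => WithBot V → WithBot V) := ⟨Transformation.toFun⟩

/-- The loss of a transformation: the number of vertices sent to `⊥`. -/
noncomputable def loss (φ : Transformation V) : ℕ :=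
  {v : V | φ v = ⊥}.ncard

/-- Edge-constrained: every vertex whose image is a vertex is sent to one of its neighbours. -/
def IsEdgeConstrained (G : SimpleGraph V) (φ : Transformation V) : Prop :=
  ∀ v w : V, φ v = w → G.Adj v w

/-- Strongly neighbourhood-preserving: among the vertices whose image is a vertex, two vertices are
adjacent if and only if their images are. -/
def IsStronglyNeighborhoodPreserving (G : SimpleGraph V) (φ : Transformation V) : Prop :=
  ∀ v₁ v₂ w₁ w₂ : V, φ v₁ = w₁ → φ v₂ = w₂ → (G.Adj v₁ v₂ ↔ G.Adj w₁ w₂)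

/-- A translation on a graph. -/
def IsTranslation (G : SimpleGraph V) (ψ : Transformation V) : Prop :=
  IsEdgeConstrained G ψ ∧ IsStronglyNeighborhoodPreserving G ψ

/-- The relation `ψ₁ ≺ ψ₂`: the loss of `ψ₁` is larger than that of `ψ₂`, and the two maps agree on
some vertex. -/
def Prec (ψ₁ ψ₂ : Transformation V) : Prop :=
  loss ψ₁ > loss ψ₂ ∧ ∃ v : V, ψ₁ v = ψ₂ v

/-- A translation `ψ₁` is minimal if there is no translation `ψ₂` with `ψ₁ ≺ ψ₂`. -/
def IsMinimalTranslation (G : SimpleGraph V) (ψ₁ : Transformation V) : Prop :=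
  IsTranslation G ψ₁ ∧ ¬ ∃ ψ₂ : Transformation V, IsTranslation G ψ₂ ∧ Prec ψ₁ ψ₂

end General

/-- The vertex set `⟦1, d[1]⟧ × ⋯ × ⟦1, d[D]⟧` of the grid graph of dimensions `d`. Axes are indexed
by `Fin D`, so the axis numbered `i` in `1, …, D` is the index `i - 1` here. -/
noncomputable def gridVertices {D : ℕ} (d : Fin D → ℕ) : Finset (Fin D → ℤ) :=
  Fintype.piFinset fun i => Finset.Icc (1 : ℤ) (d i)

/-- The grid graph of dimensions `d`. -/
def gridGraph {D : ℕ} (d : Fin D → ℕ) : SimpleGraph (gridVertices d) where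
  Adj v w := ∃ i, |v.1 i - w.1 i| = 1 ∧ ∀ j, j ≠ i → v.1 j = w.1 j
  symm := ⟨by
    rintro v w ⟨i, hi, hj⟩
    exact ⟨i, by rw [abs_sub_comm]; exact hi, fun j h => (hj j h).symm⟩⟩
  loopless := ⟨by
    rintro v ⟨i, hi, -⟩
    simp at hi⟩

open Classical in
/-- The Euclidean translation by `δ` on the grid graph: `v` is sent to `v + δ` if that is a vertex
of the grid, and to `⊥` otherwise. -/
noncomputable def euclideanTranslation {D : ℕ} (d : Fin D → ℕ) (δ : Fin D → ℤ) :
    Transformation (gridVertices d) where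
  toFun x := WithBot.recBotCoe ⊥
    (fun v : gridVertices d =>
      if h : v.1 + δ ∈ gridVertices d then
        ((⟨v.1 + δ, h⟩ : gridVertices d) : WithBot (gridVertices d))
      else ⊥) x
  injective' := by
    intro v₁ v₂ h₁ h₂ h
    simp only [WithBot.recBotCoe_coe] at h₁ h₂ h
    by_cases a : v₁.1 + δ ∈ gridVertices d
    · by_cases b : v₂.1 + δ ∈ gridVertices d
      · rw [dif_pos a, dif_pos b] at h
        exact Subtype.ext (add_right_cancel (congrArg Subtype.val (WithBot.coe_injective h)))
      · exact absurd (dif_neg b) h₂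
    · exact absurd (dif_neg a) h₁
  map_bot' := rfl

/-- The growth assumption: the last dimension is at least `3`, and every other dimension is at least
`2` plus twice the product of the dimensions that follow it. The number of axes is `n + 1`. -/
def IsLargeGrid {n : ℕ} (d : Fin (n + 1) → ℕ) : Prop :=
  3 ≤ d (Fin.last n) ∧ ∀ i, i ≠ Fin.last n → 2 + 2 * ∏ j ∈ Finset.Ioi i, d j ≤ d i

end GraphTranslation

namespace GraphTranslation

/-! Let N be the product of all dimensions but the first, the size of a slice (a level set of the
first coordinate). The Euclidean translation loses exactly the last slice, N vertices, and no
translation loses fewer (`IsTranslation.prod_le_loss`).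

Suppose a translation loses fewer than N. Since the first axis has length at least 2N, some two
consecutive slices lose nothing (`exists_lossless_pair`). On this box, of thickness 2 and with all
other sides at least 3, injectivity together with unit displacements forces edges inside a slice to
be carried to parallel edges (`step_eq_single`). So each slice moves rigidly, and by ±e₁, since any
other direction would leave the grid (`exists_displacement`).

The two signs leave four cases. If they are equal, a half-grid is injected into itself minus a
slice. If the slices move towards each other they are swapped, and a neighbouring slice is lost
(`eq_bot_of_swap`). If they move apart, adjacency breaks. -/

/-- `u` is plus or minus a vector of the standard basis. -/
def IsUnitStep {ι : Type*} (u : ι → ℤ) : Prop :=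
  ∃ i, |u i| = 1 ∧ ∀ j, j ≠ i → u j = 0

/-! ### Rigidity of translations on boxes of integer points -/

section Rigidity

variable {ι : Type*}

theorem IsUnitStep.bounds {u : ι → ℤ} (h : IsUnitStep u) (i : ι) : -1 ≤ u i ∧ u i ≤ 1 := by
  obtain ⟨p, hp, hp'⟩ := h
  by_cases hi : i = p
  · subst hi; exact abs_le.1 hp.le
  · rw [hp' i hi]; omega

theorem IsUnitStep.eq_zero {u : ι → ℤ} (h : IsUnitStep u) {i j : ι} (hi : u i ≠ 0) (hj : j ≠ i) :
    u j = 0 := by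
  obtain ⟨p, hp, hp'⟩ := h
  have : i = p := by by_contra h; exact hi (hp' i h)
  subst this; exact hp' j hj

theorem IsUnitStep.neg {u : ι → ℤ} (h : IsUnitStep u) : IsUnitStep (-u) := by
  obtain ⟨p, hp, hp'⟩ := h
  exact ⟨p, by simpa using hp, fun j hj => by simp [hp' j hj]⟩

theorem IsUnitStep.ext_of_ne_zero {u v : ι → ℤ} (hu : IsUnitStep u) (hv : IsUnitStep v) {i : ι}
    (hi : u i ≠ 0) (h : u i = v i) : u = v := by
  funext j
  by_cases hj : j = i
  · rw [hj, h]
  · rw [hu.eq_zero hi hj, hv.eq_zero (h ▸ hi) hj]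

/-- Two unit steps with a nonzero sum are determined by it up to order. -/
theorem IsUnitStep.eq_or_eq_of_add_eq {u v u' v' : ι → ℤ} (hu : IsUnitStep u) (hv : IsUnitStep v)
    (hu' : IsUnitStep u') (hv' : IsUnitStep v') (h : u + v' = v + u') (h0 : u + v' ≠ 0) :
    u = v ∨ u = u' := by
  have h' : ∀ i, u i + v' i = v i + u' i := fun i => congrFun h i
  obtain ⟨p, hp, hp'⟩ := id hu
  have hp0 : u p ≠ 0 := by intro h; simp [h] at hp
  by_contra! hne
  have a1 : u p ≠ v p := fun h => hne.1 (hu.ext_of_ne_zero hv hp0 h)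
  have a2 : u p ≠ u' p := fun h => hne.2 (hu.ext_of_ne_zero hu' hp0 h)
  have a3 : v' p ≠ - u p := fun h => h0 (by
    have := hu.neg.ext_of_ne_zero hv' (i := p) (by simpa using hp0) (by simp [h])
    rw [← this]; simp)
  have b1 := hu.bounds p
  have b2 := hv.bounds p
  have b3 := hu'.bounds p
  have b4 := hv'.bounds p
  -- At the axis `p` of `u`, say with `u p = 1`, the left side is at least 1 and the right side at
  -- most 0.
  have := h' p
  omega

theorem apply_le_of_mem_Icc {lo hi x : ι → ℤ} (hx : x ∈ Set.Icc lo hi) (i : ι) :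
    lo i ≤ x i ∧ x i ≤ hi i :=
  ⟨hx.1 i, hx.2 i⟩

variable [DecidableEq ι]

theorem IsUnitStep.eq_single {u : ι → ℤ} (h : IsUnitStep u) {i : ι} {c : ℤ} (hc : c ≠ 0)
    (hi : u i = c) : u = Pi.single i c := by
  funext j
  by_cases hj : j = i
  · subst hj; simp [hi]
  · simp [hj, h.eq_zero (hi ▸ hc) hj]

theorem mem_Icc_add_single {lo hi x : ι → ℤ} (hx : x ∈ Set.Icc lo hi) (i : ι) (c : ℤ)
    (h1 : lo i ≤ x i + c) (h2 : x i + c ≤ hi i) : x + Pi.single i c ∈ Set.Icc lo hi := by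
  refine ⟨fun j => ?_, fun j => ?_⟩ <;> by_cases hj : j = i
  · subst hj; simpa using h1
  · simpa [hj] using hx.1 j
  · subst hj; simpa using h2
  · simpa [hj] using hx.2 j

theorem add_single_mem_of_mem {lo hi x y : ι → ℤ} {i : ι} {c : ℤ}
    (hx : x + Pi.single i c ∈ Set.Icc lo hi) (hy : y ∈ Set.Icc lo hi) (hxy : y i = x i) :
    y + Pi.single i c ∈ Set.Icc lo hi := by
  have h1 := (apply_le_of_mem_Icc hx i).1
  have h2 := (apply_le_of_mem_Icc hx i).2
  simp only [Pi.add_apply, Pi.single_eq_same] at h1 h2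
  exact mem_Icc_add_single hy i c (by omega) (by omega)

/-- An injective map of a box of integer points into `ι → ℤ` that moves every point by a unit step
and maps the edges of the box to unit steps. -/
structure IsBoxTranslation (lo hi : ι → ℤ) (F : (ι → ℤ) → ι → ℤ) : Prop where
  displacement : ∀ x ∈ Set.Icc lo hi, IsUnitStep (F x - x)
  step : ∀ x ∈ Set.Icc lo hi, ∀ i, x + Pi.single i 1 ∈ Set.Icc lo hi →
    IsUnitStep (F (x + Pi.single i 1) - F x)
  injOn : Set.InjOn F (Set.Icc lo hi)

namespace IsBoxTranslation

variable {lo hi : ι → ℤ} {F : (ι → ℤ) → ι → ℤ}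

/-- A unit square is carried to a closed walk of four unit steps whose opposite corners are distinct
by injectivity. Such a walk is again a square: opposite sides are parallel, and sides at a corner
lie on different axes. -/
theorem square (hF : IsBoxTranslation lo hi F) {x : ι → ℤ} {i j : ι} (hij : i ≠ j)
    (hx : x ∈ Set.Icc lo hi) (hi' : x + Pi.single i 1 ∈ Set.Icc lo hi)
    (hj : x + Pi.single j 1 ∈ Set.Icc lo hi) :
    F (x + Pi.single j 1 + Pi.single i 1) - F (x + Pi.single j 1) = F (x + Pi.single i 1) - F x ∧
    ∀ l, F (x + Pi.single j 1) l - F x l ≠ 0 → F (x + Pi.single i 1) l - F x l = 0 := by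
  have hji : x + Pi.single j 1 + Pi.single i 1 ∈ Set.Icc lo hi :=
    add_single_mem_of_mem hi' hj (by simp [hij])
  have comm : x + Pi.single j 1 + Pi.single i 1 = x + Pi.single i 1 + Pi.single j (1 : ℤ) := by
    abel
  have hu := hF.step x hx i hi'
  have hv := hF.step x hx j hj
  have hu' := hF.step _ hj i hji
  have hv' := hF.step _ hi' j (comm ▸ hji)
  rw [← comm] at hv'
  have ne1 : F (x + Pi.single i 1) ≠ F (x + Pi.single j 1) := by
    intro h
    have := congrFun (hF.injOn hi' hj h) i
    simp [hij] at this
  have ne2 : F (x + Pi.single j 1 + Pi.single i 1) ≠ F x := by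
    intro h
    have := congrFun (hF.injOn hji hx h) i
    simp [hij] at this
  have key : F (x + Pi.single j 1 + Pi.single i 1) - F (x + Pi.single j 1)
      = F (x + Pi.single i 1) - F x := by
    rcases hu.eq_or_eq_of_add_eq hv hu' hv' (by abel)
      (by intro h; apply ne2; rw [← sub_eq_zero, ← h]; abel) with h | h
    · exact absurd (sub_left_injective h) ne1
    · exact h.symm
  refine ⟨key, fun l hl => ?_⟩
  by_contra hne
  have b1 := hu.bounds l
  have b2 := hv.bounds l
  simp only [Pi.sub_apply] at b1 b2
  have hcases : F (x + Pi.single i 1) l - F x l = F (x + Pi.single j 1) l - F x l ∨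
    F (x + Pi.single i 1) l - F x l = -(F (x + Pi.single j 1) l - F x l) := by omega
  rcases hcases with h | h
  · exact ne1 (sub_left_injective (hu.ext_of_ne_zero hv (i := l) hne h))
  · have := hu.ext_of_ne_zero hv.neg (i := l) hne h
    rw [this] at key
    apply ne2
    rw [← sub_eq_zero]
    calc _ = (F (x + Pi.single j 1 + Pi.single i 1) - F (x + Pi.single j 1))
          + (F (x + Pi.single j 1) - F x) := by abel
      _ = 0 := by rw [key]; abel

/-- Of two consecutive steps in direction `j`, one is preserved. -/
theorem step_eq_or (hF : IsBoxTranslation lo hi F) {x : ι → ℤ} {j : ι}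
    (hx : x ∈ Set.Icc lo hi) (hx1 : x + Pi.single j 1 ∈ Set.Icc lo hi)
    (hx2 : x + Pi.single j 1 + Pi.single j 1 ∈ Set.Icc lo hi) :
    F (x + Pi.single j 1) - F x = Pi.single j 1 ∨
    F (x + Pi.single j 1 + Pi.single j 1) - F (x + Pi.single j 1) = Pi.single j 1 := by
  have hw := hF.step x hx j hx1
  have hw' := hF.step _ hx1 j hx2
  have hd := hF.displacement x hx
  have hd2 := hF.displacement _ hx2
  by_contra! hne
  have a1 : F (x + Pi.single j 1) j - F x j ≠ 1 := fun h =>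
    hne.1 (hw.eq_single one_ne_zero h)
  have a2 : F (x + Pi.single j 1 + Pi.single j 1) j - F (x + Pi.single j 1) j ≠ 1 := fun h =>
    hne.2 (hw'.eq_single one_ne_zero h)
  have b1 := hw.bounds j
  have b2 := hw'.bounds j
  have b3 := hd.bounds j
  have b4 := hd2.bounds j
  simp only [Pi.sub_apply, Pi.add_apply, Pi.single_eq_same] at b1 b2 b3 b4
  -- Along `j` the two ends start 2 apart and each moves by at most 1, while the images do not
  -- advance. Both displacements must then lie along `j`, and both ends land on the midpoint.
  have : F (x + Pi.single j 1 + Pi.single j 1) = F x := by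
    funext l
    by_cases hl : l = j
    · subst hl; omega
    · have c1 := hd.eq_zero (i := j) (j := l) (by simp only [Pi.sub_apply]; omega) hl
      have c2 := hd2.eq_zero (i := j) (j := l)
        (by simp only [Pi.sub_apply, Pi.add_apply, Pi.single_eq_same]; omega) hl
      simp only [Pi.sub_apply, Pi.add_apply, Pi.single_eq_of_ne hl] at c1 c2
      omega
  have := congrFun (hF.injOn hx2 hx this) j
  simp at this
  omega

/-- Every point of a long axis lies on a path of three points in the direction of that axis. -/
theorem exists_start {j : ι} (hlong : lo j + 2 ≤ hi j) {x : ι → ℤ} (hx : x ∈ Set.Icc lo hi) :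
    ∃ y ∈ Set.Icc lo hi, y + Pi.single j 1 ∈ Set.Icc lo hi ∧
      y + Pi.single j 1 + Pi.single j 1 ∈ Set.Icc lo hi ∧
      (x = y ∨ x = y + Pi.single j 1 ∨ x = y + Pi.single j 1 + Pi.single j 1) := by
  have h1 := (apply_le_of_mem_Icc hx j).1
  have h2 := (apply_le_of_mem_Icc hx j).2
  have main : ∀ c : ℤ, lo j ≤ x j + c → x j + c + 2 ≤ hi j →
      x + Pi.single j c ∈ Set.Icc lo hi ∧ x + Pi.single j c + Pi.single j 1 ∈ Set.Icc lo hi ∧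
      x + Pi.single j c + Pi.single j 1 + Pi.single j 1 ∈ Set.Icc lo hi := by
    intro c hc hc'
    have m0 := mem_Icc_add_single hx j c hc (by omega)
    have m1 := mem_Icc_add_single m0 j 1 (by simp; omega) (by simp; omega)
    exact ⟨m0, m1, mem_Icc_add_single m1 j 1 (by simp; omega) (by simp; omega)⟩
  rcases (by omega : x j + 2 ≤ hi j ∨ (lo j ≤ x j - 1 ∧ x j + 1 ≤ hi j) ∨ lo j ≤ x j - 2)
    with h | h | h
  · obtain ⟨m0, m1, m2⟩ := main 0 (by omega) (by omega)
    exact ⟨_, m0, m1, m2, Or.inl (by simp)⟩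
  · obtain ⟨m0, m1, m2⟩ := main (-1) (by omega) (by omega)
    exact ⟨_, m0, m1, m2, Or.inr (Or.inl (by simp [add_assoc, ← Pi.single_add]))⟩
  · obtain ⟨m0, m1, m2⟩ := main (-2) (by omega) (by omega)
    exact ⟨_, m0, m1, m2, Or.inr (Or.inr (by simp [add_assoc, ← Pi.single_add]))⟩

/-- Steps in direction `i` are orthogonal to every other long axis. -/
theorem step_apply_eq_zero (hF : IsBoxTranslation lo hi F) {x : ι → ℤ} {i j : ι} (hij : i ≠ j)
    (hlong : lo j + 2 ≤ hi j) (hx : x ∈ Set.Icc lo hi)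
    (hxi : x + Pi.single i 1 ∈ Set.Icc lo hi) :
    F (x + Pi.single i 1) j - F x j = 0 := by
  obtain ⟨y, m0, m1, m2, hxy⟩ := exists_start hlong hx
  have hyx : y i = x i := by rcases hxy with h | h | h <;> simp [h, hij]
  have s1 := hF.square hij m0 (add_single_mem_of_mem hxi m0 hyx) m1
  have s2 := hF.square hij m1 (add_single_mem_of_mem hxi m1 (by simp [hyx, hij])) m2
  have e1 := congrFun s1.1 j
  have e2 := congrFun s2.1 j
  simp only [Pi.sub_apply] at e1 e2
  -- A preserved step of the path uses axis `j`, so the `i`-side of its square avoids `j`; parallel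
  -- opposite sides carry this along the whole path.
  have hz : F (y + Pi.single i 1) j - F y j = 0 := by
    rcases hF.step_eq_or m0 m1 m2 with h | h
    · exact s1.2 j (by have := congrFun h j; simp at this; omega)
    · have := s2.2 j (by have := congrFun h j; simp at this; omega)
      omega
  rcases hxy with h | h | h <;> subst h <;> omega

/-- If all axes but `o` are long, then steps in directions other than `o` are preserved. -/
theorem step_eq_single (hF : IsBoxTranslation lo hi F) {o : ι} (ho : lo o + 1 ≤ hi o)
    (hlong : ∀ i, i ≠ o → lo i + 2 ≤ hi i) {x : ι → ℤ} {i : ι} (hio : i ≠ o)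
    (hx : x ∈ Set.Icc lo hi) (hxi : x + Pi.single i 1 ∈ Set.Icc lo hi) :
    F (x + Pi.single i 1) - F x = Pi.single i 1 := by
  -- The image of an `o`-step avoids every long axis, so only `o` remains.
  have short : ∀ y ∈ Set.Icc lo hi, y + Pi.single o 1 ∈ Set.Icc lo hi →
      F (y + Pi.single o 1) o - F y o ≠ 0 := by
    intro y hy hyo h0
    obtain ⟨p, hp, -⟩ := hF.step y hy o hyo
    have : F (y + Pi.single o 1) p - F y p = 0 := by
      by_cases hpo : p = o
      · rw [hpo, h0]
      · exact hF.step_apply_eq_zero (Ne.symm hpo) (hlong p hpo) hy hyo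
    simp [this] at hp
  have orth : ∀ y ∈ Set.Icc lo hi, y + Pi.single i 1 ∈ Set.Icc lo hi →
      F (y + Pi.single i 1) o - F y o = 0 := by
    intro y hy hyi
    by_cases h : y o + 1 ≤ hi o
    · have hyo := mem_Icc_add_single hy o 1 (by have := (apply_le_of_mem_Icc hy o).1; omega) h
      exact (hF.square hio hy hyi hyo).2 o (short y hy hyo)
    · have hz := mem_Icc_add_single hy o (-1) (by have := (apply_le_of_mem_Icc hy o).1; omega)
        (by have := (apply_le_of_mem_Icc hy o).2; omega)
      have hy' : y = y + Pi.single o (-1) + Pi.single o 1 := by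
        simp [add_assoc, ← Pi.single_add]
      generalize y + Pi.single o (-1) = z at hz hy'
      subst hy'
      have hzi : z + Pi.single i 1 ∈ Set.Icc lo hi :=
        add_single_mem_of_mem hyi hz (by simp [hio])
      have s := hF.square hio hz hzi hy
      have e := congrFun s.1 o
      simp only [Pi.sub_apply] at e
      rw [e]
      exact s.2 o (short z hz hy)
  have pm : ∀ y ∈ Set.Icc lo hi, y + Pi.single i 1 ∈ Set.Icc lo hi →
      F (y + Pi.single i 1) - F y = Pi.single i 1 ∨
      F (y + Pi.single i 1) - F y = Pi.single i (-1) := by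
    intro y hy hyi
    have hu := hF.step y hy i hyi
    obtain ⟨p, hp, -⟩ := id hu
    have hpi : p = i := by
      by_contra hpi
      have : F (y + Pi.single i 1) p - F y p = 0 := by
        by_cases hpo : p = o
        · rw [hpo, orth y hy hyi]
        · exact hF.step_apply_eq_zero (Ne.symm hpi) (hlong p hpo) hy hyi
      simp [this] at hp
    subst hpi
    rcases eq_or_eq_neg_of_abs_eq hp with h | h
    · exact Or.inl (hu.eq_single (by norm_num) h)
    · exact Or.inr (hu.eq_single (by norm_num) h)
  -- One of the two steps is preserved; a reversed other step would fold the path onto itself.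
  have fold : ∀ y ∈ Set.Icc lo hi, y + Pi.single i 1 ∈ Set.Icc lo hi →
      y + Pi.single i 1 + Pi.single i 1 ∈ Set.Icc lo hi →
      F (y + Pi.single i 1) - F y = Pi.single i 1 ∧
      F (y + Pi.single i 1 + Pi.single i 1) - F (y + Pi.single i 1) = Pi.single i 1 := by
    intro y m0 m1 m2
    have ne : F (y + Pi.single i 1 + Pi.single i 1) ≠ F y := by
      intro h
      have := congrFun (hF.injOn m2 m0 h) i
      simp at this
      omega
    have cancel : ∀ c : ℤ, F (y + Pi.single i 1) - F y = Pi.single i c →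
        F (y + Pi.single i 1 + Pi.single i 1) - F (y + Pi.single i 1) ≠ Pi.single i (-c) := by
      intro c h h'
      apply ne
      rw [← sub_eq_zero, ← sub_add_sub_cancel _ (F (y + Pi.single i 1)), h, h']
      simp [← Pi.single_add]
    rcases hF.step_eq_or m0 m1 m2 with h | h
    · exact ⟨h, (pm _ m1 m2).resolve_right (cancel 1 h)⟩
    · refine ⟨(pm _ m0 m1).resolve_right fun h' => cancel (-1) h' (by simpa using h), h⟩
  -- The edge is completed to a path of three points, forwards if there is room and backwards
  -- otherwise.
  by_cases h : x i + 2 ≤ hi i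
  · exact (fold x hx hxi (mem_Icc_add_single hxi i 1 (by have := (apply_le_of_mem_Icc hx i).1; simp; omega)
      (by simp; omega))).1
  · have h2 := (apply_le_of_mem_Icc hxi i).2
    have h3 := hlong i hio
    simp only [Pi.add_apply, Pi.single_eq_same] at h2
    have hz := mem_Icc_add_single hx i (-1) (by omega) (by omega)
    have hx' : x = x + Pi.single i (-1) + Pi.single i 1 := by
      simp [add_assoc, ← Pi.single_add]
    generalize x + Pi.single i (-1) = z at hz hx'
    subst hx'
    exact (fold z hz hx hxi).2

end IsBoxTranslation

/-- A function on a box that does not change along edges in directions other than `o` depends only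
on the coordinate `o`. -/
theorem eq_of_forall_add_single_eq [Fintype ι] {α : Type*} {lo hi : ι → ℤ} {o : ι}
    {g : (ι → ℤ) → α}
    (h : ∀ x ∈ Set.Icc lo hi, ∀ i, i ≠ o → x + Pi.single i 1 ∈ Set.Icc lo hi →
      g (x + Pi.single i 1) = g x)
    {x y : ι → ℤ} (hx : x ∈ Set.Icc lo hi) (hy : y ∈ Set.Icc lo hi) (hxy : x o = y o) :
    g x = g y := by
  have climb : ∀ i, i ≠ o → ∀ n : ℕ, ∀ z ∈ Set.Icc lo hi, z + Pi.single i (n : ℤ) ∈ Set.Icc lo hi →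
      g (z + Pi.single i (n : ℤ)) = g z := by
    intro i hio n
    induction n with
    | zero => intro z _ _; simp
    | succ n ih =>
      intro z hz hz'
      have b1 := (apply_le_of_mem_Icc hz i).1
      have b2 := (apply_le_of_mem_Icc hz' i).2
      simp only [Pi.add_apply, Pi.single_eq_same] at b2
      push_cast at b2
      have m := mem_Icc_add_single hz i (n : ℤ) (by omega) (by omega)
      have e : z + Pi.single i ((n + 1 : ℕ) : ℤ) = z + Pi.single i (n : ℤ) + Pi.single i 1 := by
        rw [add_assoc, ← Pi.single_add]; push_cast; rfl
      rw [e] at hz' ⊢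
      rw [h _ m i hio hz', ih z hz m]
  have upd : ∀ i, i ≠ o → ∀ z ∈ Set.Icc lo hi, ∀ t, lo i ≤ t → t ≤ hi i →
      Function.update z i t ∈ Set.Icc lo hi ∧ g (Function.update z i t) = g z := by
    intro i hio z hz t h1 h2
    have e : Function.update z i t = z + Pi.single i (t - z i) := by
      funext j
      by_cases hj : j = i
      · subst hj; simp
      · simp [hj]
    have m := mem_Icc_add_single hz i (t - z i) (by omega) (by omega)
    rw [e]
    refine ⟨m, ?_⟩
    rcases le_total 0 (t - z i) with hc | hc
    · obtain ⟨n, hn⟩ := Int.eq_ofNat_of_zero_le hc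
      rw [hn] at m ⊢
      exact climb i hio n z hz m
    · obtain ⟨n, hn⟩ := Int.eq_ofNat_of_zero_le (neg_nonneg.2 hc)
      have e' : z = z + Pi.single i (t - z i) + Pi.single i (n : ℤ) := by
        rw [← hn, add_assoc, ← Pi.single_add]; simp
      have := climb i hio n _ m (e' ▸ hz)
      rw [← e'] at this
      exact this.symm
  -- The coordinates of `x` are replaced by those of `y` one at a time, never touching `o`.
  have piece : ∀ s : Finset ι, o ∉ s →
      s.piecewise y x ∈ Set.Icc lo hi ∧ g (s.piecewise y x) = g x := by
    intro s
    induction s using Finset.induction_on with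
    | empty => intro _; simpa using hx
    | insert i s _ ih =>
      intro ho
      simp only [Finset.mem_insert, not_or] at ho
      obtain ⟨m, e⟩ := ih ho.2
      rw [Finset.piecewise_insert]
      have := upd i (Ne.symm ho.1) _ m (y i) (hy.1 i) (hy.2 i)
      exact ⟨this.1, this.2.trans e⟩
  have e : (Finset.univ.erase o).piecewise y x = y := by
    funext j
    by_cases hj : j = o
    · subst hj; simp [hxy]
    · simp [Finset.piecewise, hj]
  have := (piece (Finset.univ.erase o) (by simp)).2
  rw [e] at this
  exact this.symm

end Rigidity

/-! ### Slices of the grid, losses and the minimality bound -/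

section Grid

theorem mem_gridVertices {D : ℕ} {d : Fin D → ℕ} {x : Fin D → ℤ} :
    x ∈ gridVertices d ↔ ∀ i, 1 ≤ x i ∧ x i ≤ d i := by
  simp [gridVertices]

theorem gridGraph_adj {D : ℕ} {d : Fin D → ℕ} {v w : gridVertices d} :
    (gridGraph d).Adj v w ↔ IsUnitStep (v.1 - w.1) := by
  simp only [gridGraph, IsUnitStep, Pi.sub_apply, sub_eq_zero]

variable {n : ℕ} {d : Fin (n + 1) → ℕ}

theorem euclideanTranslation_coe_eq {δ : Fin (n + 1) → ℤ} {v w : gridVertices d} :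
    euclideanTranslation d δ v = w ↔ v.1 + δ = w.1 := by
  by_cases h : v.1 + δ ∈ gridVertices d
  · simp [euclideanTranslation, h, Subtype.ext_iff]
  · simp only [euclideanTranslation, WithBot.recBotCoe_coe, dif_neg h]
    exact ⟨fun h' => absurd h'.symm WithBot.coe_ne_bot, fun h' => absurd (h' ▸ w.2) h⟩

theorem euclideanTranslation_coe_eq_bot {δ : Fin (n + 1) → ℤ} {v : gridVertices d} :
    euclideanTranslation d δ v = ⊥ ↔ v.1 + δ ∉ gridVertices d := by
  by_cases h : v.1 + δ ∈ gridVertices d <;> simp [euclideanTranslation, h]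

theorem isTranslation_euclideanTranslation {δ : Fin (n + 1) → ℤ} (hδ : IsUnitStep δ) :
    IsTranslation (gridGraph d) (euclideanTranslation d δ) := by
  refine ⟨fun v w h => ?_, fun v₁ v₂ w₁ w₂ h₁ h₂ => ?_⟩
  · rw [euclideanTranslation_coe_eq] at h
    rw [gridGraph_adj, ← h]
    simpa using hδ.neg
  · rw [euclideanTranslation_coe_eq] at h₁ h₂
    rw [gridGraph_adj, gridGraph_adj, ← h₁, ← h₂, add_sub_add_right_eq_sub]

theorem card_slice {c : ℤ} (h1 : 1 ≤ c) (h2 : c ≤ d 0) :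
    (Finset.univ.filter fun v : gridVertices d => v.1 0 = c).card
      = ∏ j ∈ Finset.Ioi (0 : Fin (n + 1)), d j := by
  have e : (Finset.univ.filter fun v : gridVertices d => v.1 0 = c).map
      (Function.Embedding.subtype _)
      = Fintype.piFinset (Fin.cons (α := fun _ => Finset ℤ) ({c} : Finset ℤ)
          fun i : Fin n => Finset.Icc (1 : ℤ) (d i.succ)) := by
    ext x
    simp only [Finset.mem_map, Finset.mem_filter, Finset.mem_univ, true_and,
      Function.Embedding.subtype_apply, Subtype.exists, exists_and_left, exists_prop,
      Fintype.mem_piFinset, Fin.forall_fin_succ, Fin.cons_zero, Fin.cons_succ,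
      Finset.mem_singleton, Finset.mem_Icc, mem_gridVertices]
    constructor
    · rintro ⟨y, hy, h, rfl⟩
      exact ⟨hy, h.2⟩
    · rintro ⟨hx, h⟩
      exact ⟨x, hx, ⟨by omega, h⟩, rfl⟩
  rw [← Finset.card_map (Function.Embedding.subtype _), e, Fintype.card_piFinset,
    Fin.prod_univ_succ, Fin.prod_Ioi_zero]
  simp

theorem loss_eq_card (ψ : Transformation (gridVertices d))
    [DecidablePred fun v : gridVertices d => ψ v = ⊥] :
    loss ψ = (Finset.univ.filter fun v : gridVertices d => ψ v = ⊥).card := by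
  rw [loss, ← Set.ncard_coe_finset]
  simp

theorem loss_euclideanTranslation (h0 : 1 ≤ d 0) :
    loss (euclideanTranslation d (Pi.single 0 1)) = ∏ j ∈ Finset.Ioi (0 : Fin (n + 1)), d j := by
  classical
  rw [loss_eq_card, ← card_slice (c := d 0) (by exact_mod_cast h0) le_rfl]
  congr 1
  ext v
  have hv := mem_gridVertices.1 v.2
  simp only [Finset.mem_filter, Finset.mem_univ, true_and, euclideanTranslation_coe_eq_bot,
    mem_gridVertices, Fin.forall_fin_succ, Pi.add_apply, Pi.single_eq_same] at hv ⊢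
  have : ∀ i : Fin n, (Pi.single 0 1 : Fin (n + 1) → ℤ) i.succ = 0 := fun i => by simp
  simp only [this, add_zero]
  have h := hv.2
  constructor
  · intro h'
    by_contra hne
    exact h' ⟨by omega, h⟩
  · intro h' h''
    omega

/-- If a transformation maps `S` into a subset `T` of `S` that misses a slice of `S`, then it loses
at least as many vertices as the slice has. -/
theorem prod_le_loss (ψ : Transformation (gridVertices d)) {c : ℤ} (h1 : 1 ≤ c) (h2 : c ≤ d 0)
    (S T : Finset (gridVertices d)) (hTS : T ⊆ S) (hc : ∀ v, v.1 0 = c → v ∈ S ∧ v ∉ T)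
    (hmap : ∀ v ∈ S, ∀ w : gridVertices d, ψ v = w → w ∈ T) :
    ∏ j ∈ Finset.Ioi (0 : Fin (n + 1)), d j ≤ loss ψ := by
  classical
  rw [loss_eq_card, ← card_slice h1 h2]
  have hslice : (Finset.univ.filter fun v : gridVertices d => v.1 0 = c).card ≤ (S \ T).card :=
    Finset.card_le_card fun v hv => by simpa using hc v (by simpa using hv)
  -- The surviving vertices of `S` inject into `T`, so at least `|S \ T|` are lost.
  have hkept : (S.filter fun v : gridVertices d => ¬ ψ v = ⊥).card ≤ T.card := by
    rw [← Finset.card_image_of_injOn (f := fun v : gridVertices d => ψ v),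
      ← Finset.card_image_of_injective T (WithBot.coe_injective)]
    · apply Finset.card_le_card
      intro y hy
      obtain ⟨v, hv, rfl⟩ := Finset.mem_image.1 hy
      obtain ⟨hvS, hne⟩ := Finset.mem_filter.1 hv
      obtain ⟨w, hw⟩ := WithBot.ne_bot_iff_exists.1 hne
      exact Finset.mem_image.2 ⟨w, hmap v hvS w hw.symm, hw⟩
    · intro v hv w hw h
      exact ψ.injective' v w (Finset.mem_filter.1 hv).2 (Finset.mem_filter.1 hw).2 h
  have hlost : (S.filter fun v : gridVertices d => ψ v = ⊥).card
      ≤ (Finset.univ.filter fun v : gridVertices d => ψ v = ⊥).card :=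
    Finset.card_le_card (Finset.filter_subset_filter _ (Finset.subset_univ _))
  have := Finset.card_filter_add_card_filter_not (s := S) (fun v : gridVertices d => ψ v = ⊥)
  have := Finset.card_sdiff_add_card_eq_card hTS
  omega

/-- A transformation of small loss is defined on two consecutive slices. -/
theorem exists_lossless_pair (ψ : Transformation (gridVertices d))
    (h : 2 * ∏ j ∈ Finset.Ioi (0 : Fin (n + 1)), d j ≤ d 0)
    (hψ : loss ψ < ∏ j ∈ Finset.Ioi (0 : Fin (n + 1)), d j) :
    ∃ k : ℤ, 1 ≤ k ∧ k + 1 ≤ d 0 ∧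
      ∀ v : gridVertices d, v.1 0 = k ∨ v.1 0 = k + 1 → ψ v ≠ ⊥ := by
  classical
  set N := ∏ j ∈ Finset.Ioi (0 : Fin (n + 1)), d j
  by_contra! hno
  -- Otherwise each of the `N` disjoint pairs of slices `2i+1, 2i+2` contains a lost vertex.
  have hex : ∀ i : Fin N, ∃ v : gridVertices d,
      (v.1 0 = 2 * (i : ℤ) + 1 ∨ v.1 0 = 2 * (i : ℤ) + 1 + 1) ∧ ψ v = ⊥ := fun i =>
    hno (2 * (i : ℤ) + 1) (by omega) (by have := i.2; omega)
  choose f hf hf' using hex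
  rw [loss_eq_card] at hψ
  have := Finset.card_le_card_of_injOn (s := Finset.univ)
    (t := Finset.univ.filter fun v : gridVertices d => ψ v = ⊥) f (fun i _ => by simp [hf' i])
    (fun i _ j _ hij => by
      have hi := hf i
      have hj := hf j
      rw [hij] at hi
      exact Fin.ext (by omega))
  simp only [Finset.card_univ, Fintype.card_fin] at this
  omega

/-- On two consecutive slices without loss, a translation moves each slice along the first axis. -/
theorem exists_displacement (hlong : ∀ i, i ≠ 0 → 3 ≤ d i) {ψ : Transformation (gridVertices d)}
    (hψ : IsTranslation (gridGraph d) ψ) {k : ℤ} (hk : 1 ≤ k) (hk' : k + 1 ≤ d 0)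
    (hl : ∀ v : gridVertices d, v.1 0 = k ∨ v.1 0 = k + 1 → ψ v ≠ ⊥) :
    ∃ s : ℤ → ℤ, (s k = 1 ∨ s k = -1) ∧ (s (k + 1) = 1 ∨ s (k + 1) = -1) ∧
      ∀ v : gridVertices d, v.1 0 = k ∨ v.1 0 = k + 1 →
        ∃ w : gridVertices d, ψ v = w ∧ w.1 = v.1 + Pi.single 0 (s (v.1 0)) := by
  -- `ψ` is extended to all integer points, with value 0 off the two slices, so that the box results
  -- apply.
  have hex : ∀ x : Fin (n + 1) → ℤ, ∃ y : Fin (n + 1) → ℤ, ∀ hx : x ∈ gridVertices d,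
      x 0 = k ∨ x 0 = k + 1 → ∃ w : gridVertices d, ψ (⟨x, hx⟩ : gridVertices d) = w ∧ w.1 = y := by
    intro x
    by_cases hx : x ∈ gridVertices d ∧ (x 0 = k ∨ x 0 = k + 1)
    · obtain ⟨w, hw⟩ := WithBot.ne_bot_iff_exists.1 (hl ⟨x, hx.1⟩ hx.2)
      exact ⟨w.1, fun _ _ => ⟨w, hw.symm, rfl⟩⟩
    · exact ⟨0, fun h h' => absurd ⟨h, h'⟩ hx⟩
  choose F hF using hex
  let lo : Fin (n + 1) → ℤ := Function.update 1 0 k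
  let hi : Fin (n + 1) → ℤ := Function.update (fun i => (d i : ℤ)) 0 (k + 1)
  have lo0 : lo 0 = k := by simp [lo]
  have hi0 : hi 0 = k + 1 := by simp [hi]
  have los : ∀ i, i ≠ 0 → lo i = 1 := fun i h => by simp [lo, h]
  have his : ∀ i, i ≠ 0 → hi i = d i := fun i h => by simp [hi, h]
  have mem : ∀ x, x ∈ Set.Icc lo hi ↔ x ∈ gridVertices d ∧ (x 0 = k ∨ x 0 = k + 1) := by
    intro x
    rw [mem_gridVertices]
    constructor
    · intro hx
      have h0 := apply_le_of_mem_Icc hx 0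
      rw [lo0, hi0] at h0
      refine ⟨fun i => ?_, by omega⟩
      by_cases h : i = 0
      · subst h; omega
      · rw [← los i h, ← his i h]; exact apply_le_of_mem_Icc hx i
    · rintro ⟨hx, h0⟩
      have : ∀ i, lo i ≤ x i ∧ x i ≤ hi i := by
        intro i
        by_cases h : i = 0
        · subst h; rw [lo0, hi0]; omega
        · rw [los i h, his i h]; exact hx i
      exact ⟨fun i => (this i).1, fun i => (this i).2⟩
  have hF' : ∀ x ∈ Set.Icc lo hi, ∃ v w : gridVertices d, v.1 = x ∧ w.1 = F x ∧ ψ v = w := by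
    intro x hx
    obtain ⟨h1, h2⟩ := (mem x).1 hx
    obtain ⟨w, hw, hw'⟩ := hF x h1 h2
    exact ⟨⟨x, h1⟩, w, rfl, hw', hw⟩
  have hbox : IsBoxTranslation lo hi F := by
    refine ⟨fun x hx => ?_, fun x hx i hxi => ?_, fun x hx y hy hxy => ?_⟩
    · obtain ⟨v, w, rfl, hw, h⟩ := hF' x hx
      rw [← hw, ← gridGraph_adj]
      exact (hψ.1 v w h).symm
    · obtain ⟨v, w, rfl, hw, h⟩ := hF' x hx
      obtain ⟨v', w', hv', hw', h'⟩ := hF' _ hxi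
      rw [← hw, ← hw', ← gridGraph_adj, ← hψ.2 v' v w' w h' h, gridGraph_adj, hv']
      exact ⟨i, by simp, fun j hj => by simp [hj]⟩
    · obtain ⟨v, w, rfl, hw, h⟩ := hF' x hx
      obtain ⟨v', w', rfl, hw', h'⟩ := hF' y hy
      have : w = w' := Subtype.ext (hw.trans (hxy.trans hw'.symm))
      subst this
      exact congrArg Subtype.val (ψ.injective' v v' (by simp [h]) (by simp [h']) (h.trans h'.symm))
  have hconst : ∀ x ∈ Set.Icc lo hi, ∀ y ∈ Set.Icc lo hi, x 0 = y 0 → F x - x = F y - y := by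
    intro x hx y hy hxy
    refine eq_of_forall_add_single_eq (o := 0) (g := fun x => F x - x) ?_ hx hy hxy
    intro x hx i hi0' hxi
    have := hbox.step_eq_single (o := 0) (by omega)
      (fun i h => by rw [los i h, his i h]; have := hlong i h; omega) hi0' hx hxi
    rw [sub_eq_iff_eq_add] at this
    simp only [this]
    abel
  have horth : ∀ x ∈ Set.Icc lo hi, ∀ i, i ≠ 0 → F x i - x i = 0 := by
    intro x hx i h
    have hb := (hbox.displacement x hx).bounds i
    -- The displacement is constant on a slice, so it must keep every value `t` of coordinate `i` in
    -- range; `t = 1` and `t = d i` force it to vanish along `i`.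
    have upd : ∀ t : ℤ, 1 ≤ t → t ≤ d i → 1 ≤ t + (F x i - x i) ∧ t + (F x i - x i) ≤ d i := by
      intro t h1 h2
      have m : x + Pi.single i (t - x i) ∈ Set.Icc lo hi :=
        mem_Icc_add_single hx i _ (by rw [los i h]; omega) (by rw [his i h]; omega)
      have e := congrFun (hconst x hx _ m (by simp [Ne.symm h])) i
      obtain ⟨v, w, hv, hw, -⟩ := hF' _ m
      have := mem_gridVertices.1 w.2 i
      rw [hw] at this
      simp only [Pi.sub_apply, Pi.add_apply, Pi.single_eq_same] at e
      omega
    have := hlong i h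
    have u1 := upd 1 le_rfl (by omega)
    have u2 := upd (d i) (by omega) le_rfl
    omega
  have hunit : ∀ x ∈ Set.Icc lo hi,
      F x = x + Pi.single 0 (F x 0 - x 0) ∧ (F x 0 - x 0 = 1 ∨ F x 0 - x 0 = -1) := by
    intro x hx
    refine ⟨?_, ?_⟩
    · funext i
      by_cases h : i = 0
      · subst h; simp
      · have := horth x hx i h
        simp only [Pi.add_apply, Pi.single_eq_of_ne h]
        omega
    · obtain ⟨p, hp, -⟩ := hbox.displacement x hx
      by_cases h : p = 0
      · subst h; exact eq_or_eq_neg_of_abs_eq hp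
      · simp [horth x hx p h] at hp
  have hbase : ∀ c, c = k ∨ c = k + 1 → Function.update lo 0 c ∈ Set.Icc lo hi := by
    intro c hc
    rw [mem, mem_gridVertices]
    refine ⟨fun i => ?_, by simpa using hc⟩
    by_cases h : i = 0
    · subst h; simp; omega
    · have := hlong i h
      simp [h, los i h]; omega
  refine ⟨fun c => F (Function.update lo 0 c) 0 - Function.update lo 0 c 0,
    (hunit _ (hbase k (Or.inl rfl))).2, (hunit _ (hbase (k + 1) (Or.inr rfl))).2, fun v hv => ?_⟩
  obtain ⟨w, hw, hw'⟩ := hF v.1 v.2 hv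
  have m := (mem v.1).2 ⟨v.2, hv⟩
  refine ⟨w, hw, ?_⟩
  have e := congrFun (hconst v.1 m _ (hbase _ hv) (by simp)) 0
  simp only [Pi.sub_apply] at e
  beta_reduce
  rw [hw', ← e]
  exact (hunit v.1 m).1

/-- A slice next to two slices that are swapped is lost. -/
theorem eq_bot_of_swap {ψ : Transformation (gridVertices d)} (hψ : IsTranslation (gridGraph d) ψ)
    {ε : ℤ} (hε : ε = 1 ∨ ε = -1) {v u u' : gridVertices d}
    (hu : u.1 = v.1 + Pi.single 0 ε) (hu' : u'.1 = v.1 + Pi.single 0 (2 * ε))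
    (h : ψ u = u') (h' : ψ u' = u) : ψ v = ⊥ := by
  by_contra hne
  obtain ⟨w, hw⟩ := WithBot.ne_bot_iff_exists.1 hne
  have a1 := gridGraph_adj.1 (hψ.1 v w hw.symm)
  -- `w` is adjacent to both `v` and `u'`, whose only common neighbour is the midpoint `u`, already
  -- the image of `u'`.
  have a2 : IsUnitStep (u'.1 - w.1) := by
    rw [← gridGraph_adj, ← hψ.2 u v u' w h hw.symm, gridGraph_adj, hu, add_sub_cancel_left]
    exact ⟨0, by rcases hε with rfl | rfl <;> simp, fun j hj => by simp [hj]⟩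
  have b1 := a1.bounds 0
  have b2 := a2.bounds 0
  rw [hu'] at b2
  simp only [Pi.sub_apply, Pi.add_apply, Pi.single_eq_same] at b1 b2
  have e := a1.eq_single (c := -ε) (by omega) (i := 0) (by simp only [Pi.sub_apply]; omega)
  have hwu : w = u := Subtype.ext (by
    rw [hu, ← sub_eq_zero]
    have : w.1 - (v.1 + Pi.single 0 ε) = -(v.1 - w.1) - Pi.single 0 ε := by abel
    rw [this, e, ← Pi.single_neg, neg_neg, sub_self])
  have := ψ.injective' v u' hne (by simp [h']) (by rw [h', ← hw, hwu])
  have := congrFun (congrArg Subtype.val this) 0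
  rw [hu'] at this
  simp at this
  omega

/-- Every translation on a large grid loses at least a slice. -/
theorem IsTranslation.prod_le_loss (h0 : 3 ≤ d 0) (hlong : ∀ i, i ≠ 0 → 3 ≤ d i)
    (hbig : 2 * ∏ j ∈ Finset.Ioi (0 : Fin (n + 1)), d j ≤ d 0)
    {ψ : Transformation (gridVertices d)} (hψ : IsTranslation (gridGraph d) ψ) :
    ∏ j ∈ Finset.Ioi (0 : Fin (n + 1)), d j ≤ loss ψ := by
  classical
  by_contra! hlt
  obtain ⟨k, hk, hk', hl⟩ := exists_lossless_pair ψ hbig hlt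
  obtain ⟨s, hs, hs', H⟩ := exists_displacement hlong hψ hk hk' hl
  refine hlt.not_ge ?_
  have step : ∀ v w : gridVertices d, ψ v = w → v.1 0 - 1 ≤ w.1 0 ∧ w.1 0 ≤ v.1 0 + 1 := by
    intro v w h
    have := (gridGraph_adj.1 (hψ.1 v w h)).bounds 0
    simp only [Pi.sub_apply] at this
    omega
  have known : ∀ v w : gridVertices d, ψ v = w → v.1 0 = k ∨ v.1 0 = k + 1 →
      w.1 0 = v.1 0 + s (v.1 0) := by
    intro v w h hv
    obtain ⟨w', hw', e⟩ := H v hv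
    rw [h] at hw'
    rw [WithBot.coe_injective hw', e]
    simp
  have shift : ∀ v : gridVertices d, ∀ c : ℤ, 1 ≤ v.1 0 + c → v.1 0 + c ≤ d 0 →
      ∃ u : gridVertices d, u.1 = v.1 + Pi.single 0 c := by
    intro v c h1 h2
    refine ⟨⟨_, mem_gridVertices.2 fun i => ?_⟩, rfl⟩
    by_cases h : i = 0
    · subst h; simpa using ⟨h1, h2⟩
    · simpa [h] using mem_gridVertices.1 v.2 i
  have lost : ∀ c : ℤ, 1 ≤ c → c ≤ d 0 → (∀ v : gridVertices d, v.1 0 = c → ψ v = ⊥) →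
      ∏ j ∈ Finset.Ioi (0 : Fin (n + 1)), d j ≤ loss ψ := by
    intro c h1 h2 h
    refine GraphTranslation.prod_le_loss ψ h1 h2 (Finset.univ.filter fun v => v.1 0 = c) ∅
      (Finset.empty_subset _) (fun v hv => by simp [hv]) (fun v hv w hw => ?_)
    rw [h v (by simpa using hv)] at hw
    exact absurd hw.symm WithBot.coe_ne_bot
  -- Here `c` is the slice to be lost and `ε` points from it towards the swapped pair.
  have swap : ∀ ε c : ℤ, (ε = 1 ∨ ε = -1) → 1 ≤ c → c ≤ d 0 →
      (c + ε = k ∨ c + ε = k + 1) → (c + 2 * ε = k ∨ c + 2 * ε = k + 1) →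
      s (c + ε) = ε → s (c + 2 * ε) = -ε →
      ∏ j ∈ Finset.Ioi (0 : Fin (n + 1)), d j ≤ loss ψ := by
    intro ε c hε h1 h2 hc1 hc2 e1 e2
    refine lost c h1 h2 fun v hv => ?_
    obtain ⟨u, hu⟩ := shift v ε (by omega) (by omega)
    obtain ⟨u', hu'⟩ := shift v (2 * ε) (by omega) (by omega)
    have u0 : u.1 0 = c + ε := by simp [hu, hv]
    have u0' : u'.1 0 = c + 2 * ε := by simp [hu', hv]
    obtain ⟨w, hw, ew⟩ := H u (by omega)
    obtain ⟨w', hw', ew'⟩ := H u' (by omega)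
    rw [u0, e1, hu, add_assoc, ← Pi.single_add, ← two_mul, ← hu'] at ew
    rw [u0', e2, hu', add_assoc, ← Pi.single_add, two_mul, add_neg_cancel_right, ← hu] at ew'
    rw [Subtype.ext ew] at hw
    rw [Subtype.ext ew'] at hw'
    exact eq_bot_of_swap hψ hε hu hu' hw hw'
  rcases hs with hs | hs <;> rcases hs' with hs' | hs'
  -- Both slices move up. Vertices beyond them descend by at most 1, so nothing from the upper half
  -- reaches slice `k`.
  · refine GraphTranslation.prod_le_loss ψ hk (by omega)
      (Finset.univ.filter fun v => k ≤ v.1 0) (Finset.univ.filter fun v => k + 1 ≤ v.1 0)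
      (fun v hv => ?_) (fun v hv => ?_) (fun v hv w hw => ?_)
    all_goals simp only [Finset.mem_filter, Finset.mem_univ, true_and] at hv ⊢
    · omega
    · omega
    · have := step v w hw
      have h := known v w hw
      rcases (by omega : v.1 0 = k ∨ v.1 0 = k + 1 ∨ k + 2 ≤ v.1 0) with e | e | e
      · rw [e, hs] at h; omega
      · rw [e, hs'] at h; omega
      · omega
  -- The slices are swapped; as `d 0 ≥ 3`, slice `k + 2` or slice `k - 1` exists.
  · by_cases h : k + 2 ≤ d 0
    · refine swap (-1) (k + 2) (by simp) (by omega) h (by omega) (by omega) ?_ ?_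
      · rw [show k + 2 + -1 = k + 1 by ring, hs']
      · rw [show k + 2 + 2 * -1 = k by ring, hs, neg_neg]
    · refine swap 1 (k - 1) (by simp) (by omega) (by omega) (by omega) (by omega) ?_ ?_
      · rw [show k - 1 + 1 = k by ring, hs]
      · rw [show k - 1 + 2 * 1 = k + 1 by ring, hs']
  -- The slices move apart: two adjacent vertices get images whose first coordinates differ by 3.
  · have hne : 0 < (Finset.univ.filter fun v : gridVertices d => v.1 0 = k).card := by
      rw [card_slice hk (by omega)]; omega
    obtain ⟨v, hv⟩ := Finset.card_pos.1 hne
    replace hv : v.1 0 = k := by simpa using hv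
    obtain ⟨u, hu⟩ := shift v 1 (by omega) (by omega)
    have u0 : u.1 0 = k + 1 := by simp [hu, hv]
    obtain ⟨w, hw, -⟩ := H v (by omega)
    obtain ⟨z, hz, -⟩ := H u (by omega)
    have ew := known v w hw (by omega)
    have ez := known u z hz (by omega)
    have adj : (gridGraph d).Adj v u := by
      rw [gridGraph_adj, hu]
      exact ⟨0, by simp, fun j hj => by simp [hj]⟩
    have := (gridGraph_adj.1 ((hψ.2 v u w z hw hz).1 adj)).bounds 0
    simp only [Pi.sub_apply] at this
    rw [hv, hs] at ew
    rw [u0, hs'] at ez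
    omega
  · refine GraphTranslation.prod_le_loss ψ (c := k + 1) (by omega) (by omega)
      (Finset.univ.filter fun v => v.1 0 ≤ k + 1) (Finset.univ.filter fun v => v.1 0 ≤ k)
      (fun v hv => ?_) (fun v hv => ?_) (fun v hv w hw => ?_)
    all_goals simp only [Finset.mem_filter, Finset.mem_univ, true_and] at hv ⊢
    · omega
    · omega
    · have := step v w hw
      have h := known v w hw
      rcases (by omega : v.1 0 = k ∨ v.1 0 = k + 1 ∨ v.1 0 ≤ k - 1) with e | e | e
      · rw [e, hs] at h; omega
      · rw [e, hs'] at h; omega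
      · omega

theorem IsLargeGrid.three_le (hd : IsLargeGrid d) (i : Fin (n + 1)) : 3 ≤ d i := by
  have hpos : ∀ j, 2 ≤ d j := fun j => by
    by_cases h : j = Fin.last n
    · rw [h]; have := hd.1; omega
    · have := hd.2 j h; omega
  by_cases h : i = Fin.last n
  · rw [h]; exact hd.1
  · have := hd.2 i h
    have : 0 < ∏ j ∈ Finset.Ioi i, d j :=
      Finset.prod_pos fun j _ => by have := hpos j; omega
    omega

theorem IsLargeGrid.two_mul_prod_le (hd : IsLargeGrid d) :
    2 * ∏ j ∈ Finset.Ioi (0 : Fin (n + 1)), d j ≤ d 0 := by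
  -- With a single axis the product is empty, and the bound is `2 ≤ d 0`.
  by_cases h : (0 : Fin (n + 1)) = Fin.last n
  · have h3 := hd.1
    rw [← h] at h3
    have : Finset.Ioi (0 : Fin (n + 1)) = ∅ := by
      rw [h]; exact Finset.Ioi_eq_empty.2 fun j _ => Fin.le_last j
    rw [this, Finset.prod_empty]
    omega
  · have := hd.2 0 h
    omega

end Grid
end GraphTranslation

theorem mainTheorem3 (n : ℕ) (d : Fin (n + 1) → ℕ) (hd : GraphTranslation.IsLargeGrid d) :
    GraphTranslation.IsMinimalTranslation (GraphTranslation.gridGraph d)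
      (GraphTranslation.euclideanTranslation d (Pi.single 0 1)) := by
  have h3 := hd.three_le
  refine ⟨GraphTranslation.isTranslation_euclideanTranslation
    ⟨0, by simp, fun j hj => by simp [hj]⟩, ?_⟩
  rintro ⟨ψ, hψ, hlt, -⟩
  rw [GraphTranslation.loss_euclideanTranslation (by have := h3 0; omega)] at hlt
  exact hlt.not_ge (hψ.prod_le_loss (h3 0) (fun i _ => h3 i) hd.two_mul_prod_le)
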